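/- Let $a,b>0$, $\xi>0$, $0<A_0\le 1$, $N>0$ and $k\in\{1,2\}$ ($k=1$ is heterodyne detection, the scheme for which low-SNR operation is physically meaningful). Let $I_{\mathrm a}$ have the Gamma-Gamma density $$f_{I_{\mathrm a}}(x)=\frac{2(ab)^{(a+b)/2}}{\Gamma(a)\Gamma(b)}\,x^{(a+b)/2-1}K_{a-b}\bigl(2\sqrt{abx}\bigr),\qquad x>0,$$ where $K_\nu$ is the modified Bessel function of the second kind, and let $I_{\mathrm p}$, independent of $I_{\mathrm a}$, have the pointing-error density $$f_{I_{\mathrm p}}(x)=\frac{\xi^2}{A_0^{\xi^2}}\,x^{\xi^2-1},\qquad 0\le x\le A_0 .$$ The channel gain is $\lambda=I_{\mathrm a}I_{\mathrm p}$ with pointing error and $\lambda=I_{\mathrm a}$ without pointing error. For noise level $N$ and average power $P_{\mathrm{avg}}=\mathrm{SNR}\cdot N$, the ergodic capacity (in nats per symbol) is $$\overline C(\mathrm{SNR})=\max_{P}\ \frac1k\,\mathbb E\Bigl[\log\Bigl(1+\frac{\lambda P(\lambda)}{N}\Bigr)\Bigr],$$ the maximum being over all measurable power adaptations $P\ge 0$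 with $\mathbb E[P(\lambda)]\le P_{\mathrm{avg}}$. Write $\overline C_{\mathrm{PE}}$ and $\overline C_{\mathrm{GG}}$ for the capacity with and without pointing error. Then for every $\mathrm{SNR}>0$ both maxima are attained and finite, and, as $\mathrm{SNR}\to0^+$, $$\overline C_{\mathrm{PE}}(\mathrm{SNR})\sim\frac1k\,\frac{A_0}{4ab}\,\mathrm{SNR}\,\log^2\frac1{\mathrm{SNR}},\qquad \overline C_{\mathrm{GG}}(\mathrm{SNR})\sim\frac1k\,\frac{1}{4ab}\,\mathrm{SNR}\,\log^2\frac1{\mathrm{SNR}},$$ so that the presence of pointing error scales the low-SNR capacity by the factor $A_0$: $$\lim_{\mathrm{SNR}\to0^+}\frac{\overline C_{\mathrm{PE}}(\mathrm{SNR})}{\overline C_{\mathrm{GG}}(\mathrm{SNR})}=A_0 .$$ -/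

import Mathlib

open MeasureTheory Filter Topology
open scoped NNReal ENNReal

namespace GammaGammaChannel

/-- The modified Bessel function of the second kind `K_ν(x)`, for `x > 0`, through its standard
integral representation `K_ν(x) = ∫₀^∞ exp(-x cosh t) cosh(ν t) dt`. -/
noncomputable def besselK (ν x : ℝ) : ℝ :=
  ∫ t in Set.Ioi (0 : ℝ), Real.exp (-x * Real.cosh t) * Real.cosh (ν * t)

/-- The Gamma-Gamma probability density of the turbulence-induced intensity `I_a`. -/
noncomputable def gammaGammaPDF (a b x : ℝ) : ℝ :=
  (Set.Ioi (0 : ℝ)).indicator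
    (fun y => 2 * (a * b) ^ ((a + b) / 2) / (Real.Gamma a * Real.Gamma b)
      * y ^ ((a + b) / 2 - 1) * besselK (a - b) (2 * Real.sqrt (a * b * y))) x

/-- The law of the turbulence-induced intensity `I_a`: this is also the law of the channel gain in
the absence of pointing errors. -/
noncomputable def gammaGammaLaw (a b : ℝ) : Measure ℝ :=
  volume.withDensity (fun x => ENNReal.ofReal (gammaGammaPDF a b x))

/-- The probability density of the pointing-error intensity `I_p`, supported on `[0, A₀]`. -/
noncomputable def pointingErrorPDF (ξ A₀ x : ℝ) : ℝ :=
  (Set.Icc (0 : ℝ) A₀).indicator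
    (fun y => ξ ^ 2 / A₀ ^ (ξ ^ 2) * y ^ (ξ ^ 2 - 1)) x

/-- The law of the pointing-error intensity `I_p`. -/
noncomputable def pointingErrorLaw (ξ A₀ : ℝ) : Measure ℝ :=
  volume.withDensity (fun x => ENNReal.ofReal (pointingErrorPDF ξ A₀ x))

/-- The law of the channel gain `I = I_a * I_p` with pointing errors, for independent `I_a` and
`I_p`: the image under multiplication of the product of the two laws. -/
noncomputable def compositeLaw (a b ξ A₀ : ℝ) : Measure ℝ :=
  ((gammaGammaLaw a b).prod (pointingErrorLaw ξ A₀)).map (fun p : ℝ × ℝ => p.1 * p.2)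

/-- The average spectral efficiencies `(1/k) E[log (1 + g P(g) / N)]` (nats per symbol) of all
power adaptation schemes `P ≥ 0` with `E[P(g)] ≤ Pavg`, where the channel gain `g` has the given
law. Expectations of nonnegative quantities are taken with values in `[0, ∞]`. -/
def achievableRates (law : Measure ℝ) (k : ℕ) (N Pavg : ℝ) : Set ℝ≥0∞ :=
  {R | ∃ P : ℝ → ℝ≥0, Measurable P ∧
      ∫⁻ g, (P g : ℝ≥0∞) ∂law ≤ ENNReal.ofReal Pavg ∧
      R = (k : ℝ≥0∞)⁻¹ * ∫⁻ g, ENNReal.ofReal (Real.log (1 + g * (P g : ℝ) / N)) ∂law}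

/-- The ergodic capacity: the largest average spectral efficiency over all feasible power
adaptation schemes. -/
noncomputable def ergodicCapacity (law : Measure ℝ) (k : ℕ) (N Pavg : ℝ) : ℝ≥0∞ :=
  sSup (achievableRates law k N Pavg)

/-- The ergodic capacity as a real-valued function of the average signal-to-noise ratio
`snr = Pavg / N`. -/
noncomputable def capacityAtSNR (law : Measure ℝ) (k : ℕ) (N snr : ℝ) : ℝ :=
  (ergodicCapacity law k N (snr * N)).toReal

end GammaGammaChannel

namespace GammaGammaChannel

/-! The limits see a gain law only through its tail on the logarithmic scale, `exp (-β √t)`;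
constants, powers of `t` and the normalisation of the densities wash out. Let `s` be the SNR and `ℓ
= log (1 / s)`.

Upper bound: by weak duality with multiplier `γ`, `log (1 + g p) - γ p` is at most the positive part
of `log (g / γ)`, which is dominated by a multiple of `exp (θ (√g - √γ))`, integrable for `θ < β`.
With `√γ = ℓ / θ` the power term is `s ℓ² / θ²` and the remainder is `O(s / ℓ)`
(`capacityAtSNR_le`). Lower bound: spend all power uniformly above the threshold `t = (ℓ / θ)²`, now
with `θ > β`. The tail mass `m` there is so much larger than `s` that `t s / m → 0`, and the rate is
nearly `t s = s ℓ² / θ²` (`le_capacityAtSNR`). Letting `θ → β` from either side gives `s ℓ² / β²`,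
up to the factor `1 / k`.

It remains to find `β`. Since `K_ν(x)` decays like `exp (-x)`, the Gamma-Gamma law has `β = 2 √(a
b)`. An independent bounded factor with essential supremum `A₀` turns `β` into `β / √A₀`
(`HasSqrtExpTail.map_mul_prod`), so `1 / β²` gains exactly the factor `A₀`. -/

/-- A measure on the positive half-line whose tail is, on the logarithmic scale,
`exp (-β √t)`. -/
structure HasSqrtExpTail (μ : Measure ℝ) (β : ℝ) : Prop where
  pos : ∀ᵐ g ∂μ, 0 < g
  moment : ∀ θ, 0 < θ → θ < β → ∫⁻ g, ENNReal.ofReal (Real.exp (θ * √g)) ∂μ ≠ ∞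
  tail : ∀ θ, β < θ → ∀ᶠ t in atTop, ENNReal.ofReal (Real.exp (-(θ * √t))) ≤ μ (Set.Ioi t)

/-! ### Pointwise water-filling inequalities -/

/-- The tangent-line inequality behind water-filling at level `c = 1/γ`. -/
lemma log_le_waterfilling {c g p : ℝ} (hc : 0 < c) (hg : 0 < g) (hp : 0 ≤ p) :
    Real.log (1 + g * p) + max (c - g⁻¹) 0 / c ≤
      Real.log (1 + g * max (c - g⁻¹) 0) + p / c := by
  have h1 : 0 < 1 + g * p := by positivity
  rcases le_total (c - g⁻¹) 0 with h | h
  · rw [max_eq_right h]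
    have h2 := Real.log_le_sub_one_of_pos h1
    have h3 : g ≤ 1 / c := by
      rw [le_div_iff₀ hc]
      have : g * c ≤ g * g⁻¹ := by gcongr; linarith
      rwa [mul_inv_cancel₀ hg.ne'] at this
    have h4 : g * p ≤ p / c := by
      calc g * p ≤ 1 / c * p := by gcongr
        _ = p / c := by ring
    simp
    linarith
  · rw [max_eq_left h]
    have e : 1 + g * (c - g⁻¹) = g * c := by field_simp; ring
    rw [e]
    -- Concavity of `log`: the tangent is taken at the water-filling value `1 + g (c - g⁻¹) = g c`.
    have h5 := Real.log_le_sub_one_of_pos (div_pos h1 (mul_pos hg hc))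
    rw [Real.log_div h1.ne' (mul_pos hg hc).ne'] at h5
    have : (1 + g * p) / (g * c) - 1 + (c - g⁻¹) / c = p / c := by
      field_simp; ring
    linarith

/-- A Chernoff-type form of the duality bound: with water level `1 / γ`, the optimal log term is `2
log (√g / √γ)` when `g ≥ γ` and zero otherwise. Then `log x ≤ x - 1` and `u ≤ exp u` with `u = θ (√g
- √γ)` trade it for an exponential moment of `√g`. -/
lemma log_le_mul_add_exp {θ γ g p : ℝ} (hθ : 0 < θ) (hγ : 0 < γ) (hg : 0 < g) (hp : 0 ≤ p) :
    Real.log (1 + g * p) ≤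
      γ * p + 2 / (θ * √γ) * Real.exp (-(θ * √γ)) * Real.exp (θ * √g) := by
  have h := log_le_waterfilling (inv_pos.2 hγ) hg hp
  rw [div_inv_eq_mul, div_inv_eq_mul, mul_comm p] at h
  have hm : 0 ≤ max (γ⁻¹ - g⁻¹) 0 := le_max_right _ _
  have hs : 0 < √γ := Real.sqrt_pos.2 hγ
  have hsg : 0 < √g := Real.sqrt_pos.2 hg
  suffices Real.log (1 + g * max (γ⁻¹ - g⁻¹) 0) ≤
      2 / (θ * √γ) * Real.exp (-(θ * √γ)) * Real.exp (θ * √g) by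
    have : 0 ≤ max (γ⁻¹ - g⁻¹) 0 * γ := by positivity
    linarith
  rcases le_total (γ⁻¹ - g⁻¹) 0 with h | h
  · rw [max_eq_right h]; simp; positivity
  · rw [max_eq_left h]
    have e : 1 + g * (γ⁻¹ - g⁻¹) = (√g / √γ) ^ 2 := by
      rw [div_pow, Real.sq_sqrt hg.le, Real.sq_sqrt hγ.le]; field_simp; ring
    rw [e, Real.log_pow]
    have h1 := Real.log_le_sub_one_of_pos (div_pos hsg hs)
    have h2 := Real.add_one_le_exp (θ * √g - θ * √γ)
    have h3 : √g / √γ - 1 ≤ 1 / (θ * √γ) * Real.exp (θ * √g - θ * √γ) := by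
      calc √g / √γ - 1 = 1 / (θ * √γ) * (θ * √g - θ * √γ) := by field_simp
        _ ≤ _ := by gcongr; linarith
    calc ((2 : ℕ) : ℝ) * Real.log (√g / √γ)
        ≤ 2 * (1 / (θ * √γ) * Real.exp (θ * √g - θ * √γ)) := by push_cast; linarith
      _ = _ := by rw [sub_eq_neg_add, Real.exp_add]; ring

/-! ### Capacity under a square-root exponential tail: finiteness, attainment, two-sided bounds -/

namespace HasSqrtExpTail

variable {μ : Measure ℝ} {β : ℝ}

lemma isFiniteMeasure (h : HasSqrtExpTail μ β) (hβ : 0 < β) : IsFiniteMeasure μ := by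
  refine ⟨lt_of_le_of_lt ?_ (h.moment (β / 2) (by positivity) (by linarith)).lt_top⟩
  rw [← lintegral_one]
  refine lintegral_mono fun g => ?_
  rw [← ENNReal.ofReal_one]
  exact ENNReal.ofReal_le_ofReal (Real.one_le_exp (by positivity))

lemma exists_tail_pos (h : HasSqrtExpTail μ β) : ∃ t > 0, 0 < μ (Set.Ioi t) := by
  obtain ⟨t, ht, h0⟩ := ((h.tail (β + 1) (by linarith)).and (eventually_gt_atTop 0)).exists
  exact ⟨t, h0, lt_of_lt_of_le (by simpa using Real.exp_pos _) ht⟩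

/-- A water level with prescribed average power. -/
lemma exists_waterLevel (h : HasSqrtExpTail μ β) (hβ : 0 < β) {s : ℝ} (hs : 0 < s) :
    ∃ c > 0, ∫⁻ g, ENNReal.ofReal (max (c - g⁻¹) 0) ∂μ = ENNReal.ofReal s := by
  have := h.isFiniteMeasure hβ
  have hbd : ∀ c, 0 ≤ c → ∀ᵐ g ∂μ, ‖max (c - g⁻¹) 0‖ ≤ c := by
    intro c hc
    filter_upwards [h.pos] with g hg
    rw [Real.norm_of_nonneg (le_max_right _ _)]
    exact max_le (by have := inv_pos.2 hg; linarith) hc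
  have hmeas : ∀ c : ℝ, AEStronglyMeasurable (fun g : ℝ => max (c - g⁻¹) 0) μ := fun c => by
    exact (Measurable.max (by fun_prop) measurable_const).aestronglyMeasurable
  have hint : ∀ c, 0 ≤ c → Integrable (fun g : ℝ => max (c - g⁻¹) 0) μ := fun c hc =>
    Integrable.of_bound (hmeas c) c (hbd c hc)
  obtain ⟨t, ht, htμ⟩ := h.exists_tail_pos
  have hm : 0 < μ.real (Set.Ioi t) := ENNReal.toReal_pos htμ.ne' (measure_ne_top _ _)
  -- At level `C` the gains above `t` alone already use power `(C - t⁻¹) μ(t, ∞) = s`; level `0`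
  -- uses none, so the intermediate value theorem applies on `[0, C]`.
  set C := t⁻¹ + s / μ.real (Set.Ioi t) with hC
  have hC0 : 0 ≤ C := by positivity
  have hcont : ContinuousOn (fun c => ∫ g, max (c - g⁻¹) 0 ∂μ) (Set.Icc 0 C) := by
    refine continuousOn_of_dominated (bound := fun _ => C) (fun c _ => hmeas c) ?_
      (integrable_const _) ?_
    · intro c hc
      filter_upwards [hbd c hc.1] with g hg using hg.trans hc.2
    · exact Eventually.of_forall fun g => by fun_prop
  have hlow : s ≤ ∫ g, max (C - g⁻¹) 0 ∂μ := by
    calc s = ∫ g in Set.Ioi t, (C - t⁻¹) ∂μ := by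
          rw [setIntegral_const, hC, smul_eq_mul]; field_simp; ring
      _ ≤ ∫ g in Set.Ioi t, max (C - g⁻¹) 0 ∂μ := by
          refine setIntegral_mono_on (integrable_const _) (hint C hC0).integrableOn
            measurableSet_Ioi fun g hg => le_max_of_le_left ?_
          have : g⁻¹ ≤ t⁻¹ := inv_anti₀ ht (le_of_lt hg)
          linarith
      _ ≤ _ := setIntegral_le_integral (hint C hC0)
          (Eventually.of_forall fun g => le_max_right _ _)
  have hzero : ∫ g, max ((0 : ℝ) - g⁻¹) 0 ∂μ = 0 := by
    rw [integral_congr_ae (g := fun _ => 0), integral_zero]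
    filter_upwards [h.pos] with g hg
    have := inv_pos.2 hg
    exact max_eq_right (by linarith)
  obtain ⟨c, hc, hcs⟩ := intermediate_value_Icc hC0 hcont
    (show s ∈ Set.Icc _ _ from ⟨by simp only [hzero]; exact hs.le, hlow⟩)
  refine ⟨c, lt_of_le_of_ne hc.1 ?_, ?_⟩
  · rintro rfl
    simp only [hzero] at hcs
    exact hs.ne hcs
  · rw [← ofReal_integral_eq_lintegral_ofReal (hint c hc.1)
      (Eventually.of_forall fun g => le_max_right _ _)]
    exact congrArg _ hcs

/-- Weak duality bound on the rate of a feasible power adaptation. -/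
lemma lintegral_log_le (h : HasSqrtExpTail μ β) {N s θ γ : ℝ} (hN : 0 < N) (hs : 0 < s)
    (hθ : 0 < θ) (hγ : 0 < γ) {P : ℝ → ℝ≥0}
    (hP : Measurable P) (hPs : ∫⁻ g, (P g : ℝ≥0∞) ∂μ ≤ ENNReal.ofReal (s * N)) :
    ∫⁻ g, ENNReal.ofReal (Real.log (1 + g * (P g : ℝ) / N)) ∂μ ≤
      ENNReal.ofReal (γ * s) + ENNReal.ofReal (2 / (θ * √γ) * Real.exp (-(θ * √γ))) *
        ∫⁻ g, ENNReal.ofReal (Real.exp (θ * √g)) ∂μ := by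
  have hs' : 0 < √γ := Real.sqrt_pos.2 hγ
  calc ∫⁻ g, ENNReal.ofReal (Real.log (1 + g * (P g : ℝ) / N)) ∂μ
      ≤ ∫⁻ g, (ENNReal.ofReal (γ / N) * (P g : ℝ≥0∞) +
          ENNReal.ofReal (2 / (θ * √γ) * Real.exp (-(θ * √γ))) *
            ENNReal.ofReal (Real.exp (θ * √g))) ∂μ := by
        refine lintegral_mono_ae ?_
        filter_upwards [h.pos] with g hg
        rw [← ENNReal.ofReal_coe_nnreal, ← ENNReal.ofReal_mul (by positivity),
          ← ENNReal.ofReal_mul (by positivity), ← ENNReal.ofReal_add (by positivity)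
          (by positivity)]
        refine ENNReal.ofReal_le_ofReal ?_
        have := log_le_mul_add_exp hθ hγ hg (p := (P g : ℝ) / N) (by positivity)
        rw [mul_div_assoc, div_mul_eq_mul_div, mul_div_assoc γ]
        exact this
    _ = ENNReal.ofReal (γ / N) * ∫⁻ g, (P g : ℝ≥0∞) ∂μ + _ := by
        rw [lintegral_add_left (by fun_prop), lintegral_const_mul _ (by fun_prop),
          lintegral_const_mul _ (by fun_prop)]
    _ ≤ ENNReal.ofReal (γ / N) * ENNReal.ofReal (s * N) + _ := by gcongr
    _ = _ := by
        rw [← ENNReal.ofReal_mul (by positivity)]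
        congr 2
        field_simp

lemma ergodicCapacity_le (h : HasSqrtExpTail μ β) {N s θ γ : ℝ} {k : ℕ} (hN : 0 < N)
    (hs : 0 < s) (hθ : 0 < θ) (hγ : 0 < γ) :
    ergodicCapacity μ k N (s * N) ≤ (k : ℝ≥0∞)⁻¹ *
      (ENNReal.ofReal (γ * s) + ENNReal.ofReal (2 / (θ * √γ) * Real.exp (-(θ * √γ))) *
        ∫⁻ g, ENNReal.ofReal (Real.exp (θ * √g)) ∂μ) := by
  refine sSup_le ?_
  rintro R ⟨P, hP, hPs, rfl⟩
  gcongr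
  exact h.lintegral_log_le hN hs hθ hγ hP hPs

lemma ergodicCapacity_ne_top (h : HasSqrtExpTail μ β) (hβ : 0 < β) {N s : ℝ} {k : ℕ}
    (hk : k ≠ 0) (hN : 0 < N) (hs : 0 < s) : ergodicCapacity μ k N (s * N) ≠ ∞ := by
  refine ne_top_of_le_ne_top ?_
    (h.ergodicCapacity_le hN hs (θ := β / 2) (γ := 1) (by positivity) one_pos)
  refine ENNReal.mul_ne_top (by simpa using hk) (ENNReal.add_ne_top.2 ⟨by simp, ?_⟩)
  exact ENNReal.mul_ne_top (by simp) (h.moment _ (by positivity) (by linarith))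

/-- Water-filling attains the capacity. -/
lemma ergodicCapacity_isGreatest (h : HasSqrtExpTail μ β) (hβ : 0 < β) {N s : ℝ} (k : ℕ)
    (hN : 0 < N) (hs : 0 < s) :
    IsGreatest (achievableRates μ k N (s * N)) (ergodicCapacity μ k N (s * N)) := by
  suffices ∃ R, IsGreatest (achievableRates μ k N (s * N)) R by
    obtain ⟨R, hR⟩ := this
    rwa [ergodicCapacity, hR.isLUB.sSup_eq]
  obtain ⟨c, hc, hcs⟩ := h.exists_waterLevel hβ hs
  set W : ℝ → ℝ≥0 := fun g => Real.toNNReal (N * max (c - g⁻¹) 0) with hW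
  have hWr : ∀ g, (W g : ℝ) = N * max (c - g⁻¹) 0 := fun g =>
    Real.coe_toNNReal _ (mul_nonneg hN.le (le_max_right _ _))
  have hWm : Measurable W :=
    (measurable_const.mul (Measurable.max (by fun_prop) measurable_const)).real_toNNReal
  have hWs : ∫⁻ g, (W g : ℝ≥0∞) ∂μ = ENNReal.ofReal (s * N) := by
    calc ∫⁻ g, (W g : ℝ≥0∞) ∂μ
        = ∫⁻ g, ENNReal.ofReal N * ENNReal.ofReal (max (c - g⁻¹) 0) ∂μ := by
          refine lintegral_congr fun g => ?_
          rw [← ENNReal.ofReal_mul hN.le, ← hWr, ENNReal.ofReal_coe_nnreal]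
      _ = _ := by
          rw [lintegral_const_mul _
            (Measurable.max (by fun_prop) measurable_const).ennreal_ofReal, hcs,
            ← ENNReal.ofReal_mul hN.le, mul_comm]
  refine ⟨_, ⟨W, hWm, hWs.le, rfl⟩, ?_⟩
  rintro R ⟨P, hP, hPs, rfl⟩
  gcongr 1
  -- The Lagrange multiplier of the power constraint. The inequality is kept in additive form
  -- because subtraction in `ℝ≥0∞` truncates; the finite power terms cancel at the end.
  set κ := ENNReal.ofReal ((N * c)⁻¹) with hκ
  have key : ∫⁻ g, ENNReal.ofReal (Real.log (1 + g * (P g : ℝ) / N)) ∂μ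
        + κ * ∫⁻ g, (W g : ℝ≥0∞) ∂μ ≤
      ∫⁻ g, ENNReal.ofReal (Real.log (1 + g * (W g : ℝ) / N)) ∂μ
        + κ * ∫⁻ g, (P g : ℝ≥0∞) ∂μ := by
    rw [← lintegral_const_mul _ (by fun_prop), ← lintegral_const_mul _ (by fun_prop),
      ← lintegral_add_right _ (by fun_prop), ← lintegral_add_right _ (by fun_prop)]
    refine lintegral_mono_ae ?_
    filter_upwards [h.pos] with g hg
    have hlog : ∀ p : ℝ≥0, 0 ≤ Real.log (1 + g * (p : ℝ) / N) := fun p =>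
      Real.log_nonneg (by have : 0 ≤ g * (p : ℝ) / N := by positivity
                          linarith)
    rw [← ENNReal.ofReal_coe_nnreal, ← ENNReal.ofReal_coe_nnreal (p := P g),
      ← ENNReal.ofReal_mul (by positivity), ← ENNReal.ofReal_mul (by positivity),
      ← ENNReal.ofReal_add (hlog _) (by positivity), ← ENNReal.ofReal_add (hlog _) (by positivity)]
    refine ENNReal.ofReal_le_ofReal ?_
    have := log_le_waterfilling hc hg (p := (P g : ℝ) / N) (by positivity)
    rw [hWr]
    convert this using 3
    · rw [mul_div_assoc]
    · field_simp
    · field_simp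
    · field_simp
  have hle : ∫⁻ g, ENNReal.ofReal (Real.log (1 + g * (P g : ℝ) / N)) ∂μ
        + κ * ENNReal.ofReal (s * N) ≤
      ∫⁻ g, ENNReal.ofReal (Real.log (1 + g * (W g : ℝ) / N)) ∂μ
        + κ * ENNReal.ofReal (s * N) := by
    rw [hWs] at key
    exact key.trans (by gcongr)
  exact (ENNReal.add_le_add_iff_right (ENNReal.mul_ne_top (by simp [hκ]) (by simp))).1 hle

/-- Capacity is at least the rate of on-off signalling at threshold `t`. -/
lemma le_ergodicCapacity [IsFiniteMeasure μ] {N s t : ℝ} {k : ℕ} (hN : 0 < N) (hs : 0 < s)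
    (ht : 0 < t) (hμ : 0 < μ.real (Set.Ioi t)) :
    (k : ℝ≥0∞)⁻¹ * ENNReal.ofReal (t * s / (1 + t * s / μ.real (Set.Ioi t))) ≤
      ergodicCapacity μ k N (s * N) := by
  set m := μ.real (Set.Ioi t) with hm
  -- Constant power above `t`, scaled so that the whole budget is spent.
  set P : ℝ → ℝ≥0 := (Set.Ioi t).indicator fun _ => Real.toNNReal (s * N / m) with hPdef
  have hμm : μ (Set.Ioi t) = ENNReal.ofReal m := (ofReal_measureReal).symm
  have hP : Measurable P := measurable_const.indicator measurableSet_Ioi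
  have hPs : ∫⁻ g, (P g : ℝ≥0∞) ∂μ = ENNReal.ofReal (s * N) := by
    have : ∀ g, (P g : ℝ≥0∞) =
        (Set.Ioi t).indicator (fun _ => ENNReal.ofReal (s * N / m)) g := by
      intro g
      by_cases hg : g ∈ Set.Ioi t
      · simp only [hPdef, Set.indicator_of_mem hg]; rfl
      · simp only [hPdef, Set.indicator_of_notMem hg]; rfl
    simp_rw [this]
    rw [lintegral_indicator measurableSet_Ioi, setLIntegral_const, hμm,
      ← ENNReal.ofReal_mul (by positivity)]
    congr 1
    field_simp
  refine le_trans ?_ (le_sSup ⟨P, hP, hPs.le, rfl⟩)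
  gcongr
  have hy : 0 < 1 + t * s / m := by positivity
  calc ENNReal.ofReal (t * s / (1 + t * s / m))
      ≤ ENNReal.ofReal (Real.log (1 + t * s / m) * m) := by
        refine ENNReal.ofReal_le_ofReal ?_
        -- `log y ≥ 1 - 1 / y` gives a rate that is asymptotically `t s` once `t s / m → 0`.
        have h1 := Real.one_sub_inv_le_log_of_pos hy
        calc t * s / (1 + t * s / m) = (1 - (1 + t * s / m)⁻¹) * m := by field_simp; ring
          _ ≤ _ := by gcongr
    _ = ∫⁻ g in Set.Ioi t, ENNReal.ofReal (Real.log (1 + t * s / m)) ∂μ := by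
        rw [setLIntegral_const, hμm, ENNReal.ofReal_mul']
        positivity
    _ ≤ ∫⁻ g in Set.Ioi t, ENNReal.ofReal (Real.log (1 + g * (P g : ℝ) / N)) ∂μ := by
        refine setLIntegral_mono_ae (by fun_prop) (Eventually.of_forall fun g hg => ?_)
        refine ENNReal.ofReal_le_ofReal (Real.log_le_log hy ?_)
        simp only [hPdef, Set.indicator_of_mem hg]
        rw [Real.coe_toNNReal _ (by positivity)]
        have : g * (s * N / m) / N = g * s / m := by field_simp
        rw [this]
        have : t ≤ g := le_of_lt hg
        gcongr
    _ ≤ _ := setLIntegral_le_lintegral _ _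

/-! ### Low-SNR asymptotics -/

/-- The choice `√γ = ℓ / θ` makes `exp (-(θ √γ))` equal to the SNR `exp (-ℓ)`, so the moment term is
smaller than the power term by a factor of order `ℓ³`. -/
lemma capacityAtSNR_le (h : HasSqrtExpTail μ β) {N θ ℓ : ℝ} {k : ℕ} (hk : k ≠ 0) (hN : 0 < N)
    (hθ : 0 < θ) (hθβ : θ < β) (hℓ : 0 < ℓ) :
    capacityAtSNR μ k N (Real.exp (-ℓ)) ≤ (Real.exp (-ℓ) * ℓ ^ 2) * ((k : ℝ)⁻¹ *
      (1 / θ ^ 2 + 2 * (∫⁻ g, ENNReal.ofReal (Real.exp (θ * √g)) ∂μ).toReal / ℓ ^ 3)) := by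
  have hM := h.moment θ hθ hθβ
  have hγ : 0 < (ℓ / θ) ^ 2 := by positivity
  have hle := h.ergodicCapacity_le (k := k) hN (Real.exp_pos (-ℓ)) hθ hγ
  have htop : (k : ℝ≥0∞)⁻¹ ≠ ∞ := by simpa using hk
  have := ENNReal.toReal_mono (ENNReal.mul_ne_top htop (ENNReal.add_ne_top.2
    ⟨ENNReal.ofReal_ne_top, ENNReal.mul_ne_top ENNReal.ofReal_ne_top hM⟩)) hle
  refine this.trans (le_of_eq ?_)
  have e : θ * (ℓ / θ) = ℓ := by field_simp
  rw [ENNReal.toReal_mul, ENNReal.toReal_add ENNReal.ofReal_ne_top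
    (ENNReal.mul_ne_top ENNReal.ofReal_ne_top hM), ENNReal.toReal_mul,
    Real.sqrt_sq (by positivity), e, ENNReal.toReal_ofReal (by positivity),
    ENNReal.toReal_ofReal (by positivity), ENNReal.toReal_inv, ENNReal.toReal_natCast]
  field_simp

/-- On-off signalling at `t = (ℓ / θ)²`: the tail bound at exponent `θ'` makes SNR over tail mass at
most `exp (-((1 - θ' / θ) ℓ))`, which is small when `θ' < θ`. -/
lemma le_capacityAtSNR (h : HasSqrtExpTail μ β) (hβ : 0 < β) {N θ θ' ℓ : ℝ} {k : ℕ}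
    (hk : k ≠ 0) (hN : 0 < N) (hθ : 0 < θ) (hℓ : 0 < ℓ)
    (htail : ENNReal.ofReal (Real.exp (-(θ' * √((ℓ / θ) ^ 2)))) ≤ μ (Set.Ioi ((ℓ / θ) ^ 2))) :
    (Real.exp (-ℓ) * ℓ ^ 2) * ((k : ℝ)⁻¹ *
      (1 / θ ^ 2 / (1 + (ℓ / θ) ^ 2 * Real.exp (-((1 - θ' / θ) * ℓ))))) ≤
      capacityAtSNR μ k N (Real.exp (-ℓ)) := by
  have := h.isFiniteMeasure hβ
  rw [Real.sqrt_sq (by positivity)] at htail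
  set t := (ℓ / θ) ^ 2 with ht
  have ht0 : 0 < t := by positivity
  have hm : Real.exp (-(θ' * (ℓ / θ))) ≤ μ.real (Set.Ioi t) :=
    (ENNReal.ofReal_le_iff_le_toReal (measure_ne_top _ _)).1 htail
  have hm0 : 0 < μ.real (Set.Ioi t) := (Real.exp_pos _).trans_le hm
  have hle := le_ergodicCapacity (k := k) hN (Real.exp_pos (-ℓ)) ht0 hm0
  have h2 := ENNReal.toReal_mono (h.ergodicCapacity_ne_top hβ hk hN (Real.exp_pos (-ℓ))) hle
  refine le_trans ?_ h2
  rw [ENNReal.toReal_mul, ENNReal.toReal_inv, ENNReal.toReal_natCast,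
    ENNReal.toReal_ofReal (by positivity), mul_left_comm]
  gcongr
  calc Real.exp (-ℓ) * ℓ ^ 2 * (1 / θ ^ 2 / (1 + t * Real.exp (-((1 - θ' / θ) * ℓ))))
      = t * Real.exp (-ℓ) / (1 + t * Real.exp (-((1 - θ' / θ) * ℓ))) := by
        rw [ht]; field_simp
    _ ≤ _ := by
        have e : Real.exp (-((1 - θ' / θ) * ℓ)) =
            Real.exp (-ℓ) / Real.exp (-(θ' * (ℓ / θ))) := by
          rw [← Real.exp_sub]; congr 1; field_simp; ring
        rw [e, ← mul_div_assoc]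
        gcongr

/-- Low-SNR capacity, with `ℓ = log (1 / SNR)` as the variable. -/
lemma tendsto_capacityAtSNR_exp (h : HasSqrtExpTail μ β) (hβ : 0 < β) {N : ℝ} {k : ℕ}
    (hk : k ≠ 0) (hN : 0 < N) :
    Tendsto (fun ℓ => capacityAtSNR μ k N (Real.exp (-ℓ)) / (Real.exp (-ℓ) * ℓ ^ 2)) atTop
      (𝓝 ((k : ℝ)⁻¹ * (1 / β ^ 2))) := by
  have hcont : ContinuousAt (fun θ : ℝ => (k : ℝ)⁻¹ * (1 / θ ^ 2)) β :=
    continuousAt_const.mul (continuousAt_const.div (by fun_prop) (by positivity))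
  refine tendsto_order.2 ⟨fun x hx => ?_, fun x hx => ?_⟩
  · have hev : ∀ᶠ θ in 𝓝[>] β, x < (k : ℝ)⁻¹ * (1 / θ ^ 2) :=
      nhdsWithin_le_nhds (hcont.eventually (lt_mem_nhds hx))
    -- Lower bound. Two exponents `β < θ' < θ` are needed: `θ' > β` for the tail estimate, `θ' < θ`
    -- for the exponential to beat `ℓ²`.
    obtain ⟨θ, hθ, hβθ : β < θ⟩ := (hev.and self_mem_nhdsWithin).exists
    obtain ⟨θ', hθ', hθ''⟩ := exists_between hβθ
    have hθ0 : 0 < θ := hβ.trans hβθ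
    have hr : 0 < 1 - θ' / θ := by rw [sub_pos, div_lt_one hθ0]; exact hθ''
    have hz : Tendsto (fun ℓ : ℝ => (ℓ / θ) ^ 2 * Real.exp (-((1 - θ' / θ) * ℓ))) atTop
        (𝓝 0) := by
      have := (tendsto_rpow_mul_exp_neg_mul_atTop_nhds_zero 2 _ hr).const_mul (1 / θ ^ 2)
      rw [mul_zero] at this
      refine this.congr fun ℓ => ?_
      rw [Real.rpow_two, neg_mul]; field_simp
    have hlim : Tendsto (fun ℓ : ℝ => (k : ℝ)⁻¹ *
        (1 / θ ^ 2 / (1 + (ℓ / θ) ^ 2 * Real.exp (-((1 - θ' / θ) * ℓ))))) atTop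
        (𝓝 ((k : ℝ)⁻¹ * (1 / θ ^ 2 / (1 + 0)))) :=
      (tendsto_const_nhds.div (hz.const_add 1) (by norm_num)).const_mul _
    rw [add_zero, div_one] at hlim
    have htend : Tendsto (fun ℓ : ℝ => (ℓ / θ) ^ 2) atTop atTop :=
      (tendsto_pow_atTop two_ne_zero).comp (tendsto_id.atTop_div_const hθ0)
    filter_upwards [hlim.eventually (lt_mem_nhds hθ), eventually_gt_atTop 0,
      htend.eventually (h.tail θ' hθ')] with ℓ h1 h2 h3
    refine h1.trans_le ?_
    rw [le_div_iff₀ (by positivity), mul_comm]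
    exact h.le_capacityAtSNR hβ hk hN hθ0 h2 h3
  · have hev : ∀ᶠ θ in 𝓝[<] β, (k : ℝ)⁻¹ * (1 / θ ^ 2) < x :=
      nhdsWithin_le_nhds (hcont.eventually (gt_mem_nhds hx))
    have hev2 : ∀ᶠ θ in 𝓝[<] β, 0 < θ := nhdsWithin_le_nhds (lt_mem_nhds hβ)
    -- Upper bound: `θ` just below `β`, where the exponential moment is finite.
    obtain ⟨θ, ⟨hθ, hθ0⟩, hθβ : θ < β⟩ := ((hev.and hev2).and self_mem_nhdsWithin).exists
    set M := (∫⁻ g, ENNReal.ofReal (Real.exp (θ * √g)) ∂μ).toReal with hM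
    have hlim : Tendsto (fun ℓ : ℝ => (k : ℝ)⁻¹ * (1 / θ ^ 2 + 2 * M / ℓ ^ 3)) atTop
        (𝓝 ((k : ℝ)⁻¹ * (1 / θ ^ 2 + 0))) :=
      ((tendsto_const_nhds.div_atTop (tendsto_pow_atTop three_ne_zero)).const_add _).const_mul _
    rw [add_zero] at hlim
    filter_upwards [hlim.eventually (gt_mem_nhds hθ), eventually_gt_atTop 0] with ℓ h1 h2
    refine lt_of_le_of_lt ?_ h1
    rw [div_le_iff₀ (by positivity), mul_comm]
    exact h.capacityAtSNR_le hk hN hθ0 hθβ h2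

lemma tendsto_capacityAtSNR (h : HasSqrtExpTail μ β) (hβ : 0 < β) {N : ℝ} {k : ℕ}
    (hk : k ≠ 0) (hN : 0 < N) :
    Tendsto (fun s => capacityAtSNR μ k N s / (s * Real.log (1 / s) ^ 2)) (𝓝[>] 0)
      (𝓝 ((k : ℝ)⁻¹ * (1 / β ^ 2))) := by
  have hl : Tendsto (fun s : ℝ => Real.log (1 / s)) (𝓝[>] 0) atTop := by
    simp only [one_div]
    exact Real.tendsto_log_atTop.comp tendsto_inv_nhdsGT_zero
  refine ((h.tendsto_capacityAtSNR_exp hβ hk hN).comp hl).congr' ?_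
  filter_upwards [self_mem_nhdsWithin] with s hs
  simp only [Function.comp, one_div, Real.log_inv, neg_neg, Real.exp_log hs]

lemma isEquivalent_capacityAtSNR (h : HasSqrtExpTail μ β) (hβ : 0 < β) {N : ℝ} {k : ℕ}
    (hk : k ≠ 0) (hN : 0 < N) :
    Asymptotics.IsEquivalent (𝓝[>] (0 : ℝ)) (capacityAtSNR μ k N)
      (fun s => 1 / (k : ℝ) * (1 / β ^ 2 * s * Real.log (1 / s) ^ 2)) := by
  have hK : (k : ℝ)⁻¹ * (1 / β ^ 2) ≠ 0 := by positivity
  refine Asymptotics.isEquivalent_of_tendsto_one ?_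
  have := (h.tendsto_capacityAtSNR hβ hk hN).div_const ((k : ℝ)⁻¹ * (1 / β ^ 2))
  rw [div_self hK] at this
  refine this.congr fun s => ?_
  rw [Pi.div_apply, div_div]
  congr 1
  ring

lemma tendsto_capacityAtSNR_div {ν : Measure ℝ} {β' : ℝ} (h : HasSqrtExpTail μ β)
    (h' : HasSqrtExpTail ν β') (hβ : 0 < β) (hβ' : 0 < β') {N : ℝ} {k : ℕ}
    (hk : k ≠ 0) (hN : 0 < N) :
    Tendsto (fun s => capacityAtSNR μ k N s / capacityAtSNR ν k N s) (𝓝[>] 0)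
      (𝓝 (β' ^ 2 / β ^ 2)) := by
  have := (h.tendsto_capacityAtSNR hβ hk hN).div (h'.tendsto_capacityAtSNR hβ' hk hN)
    (by positivity)
  have e : (k : ℝ)⁻¹ * (1 / β ^ 2) / ((k : ℝ)⁻¹ * (1 / β' ^ 2)) = β' ^ 2 / β ^ 2 := by
    field_simp
  rw [e] at this
  refine this.congr' ?_
  -- For `s < 1` the logarithm is nonzero, so the common normaliser cancels.
  filter_upwards [Ioo_mem_nhdsGT (zero_lt_one' ℝ)] with s hs
  have : Real.log (1 / s) ≠ 0 := by
    rw [one_div, Real.log_inv]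
    exact neg_ne_zero.2 (Real.log_neg hs.1 hs.2).ne
  exact div_div_div_cancel_right₀ (mul_ne_zero hs.1.ne' (pow_ne_zero 2 this)) _ _

end HasSqrtExpTail

end GammaGammaChannel

/-! ### Bessel function bounds and the tail of the Gamma-Gamma law -/

namespace GammaGammaChannel

lemma cosh_le_exp_abs (x : ℝ) : Real.cosh x ≤ Real.exp |x| := by
  rw [← Real.cosh_abs, Real.cosh_eq]
  have : Real.exp (-|x|) ≤ Real.exp |x| := Real.exp_le_exp.2 (by have := abs_nonneg x; linarith)
  linarith

lemma exp_div_two_le_cosh (x : ℝ) : Real.exp x / 2 ≤ Real.cosh x := by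
  rw [Real.cosh_eq]
  have := Real.exp_pos (-x)
  linarith

lemma integrableOn_besselK_integrand (ν : ℝ) {x : ℝ} (hx : 0 < x) :
    IntegrableOn (fun t => Real.exp (-x * Real.cosh t) * Real.cosh (ν * t)) (Set.Ioi 0) := by
  refine Integrable.mono' ((integrableOn_exp_neg_Ioi 0).const_mul
    (Real.exp ((|ν| + 1) ^ 2 / x))) (by fun_prop) ?_
  filter_upwards [ae_restrict_mem measurableSet_Ioi] with t (ht : 0 < t)
  rw [Real.norm_of_nonneg (mul_nonneg (Real.exp_pos _).le (Real.cosh_pos _).le)]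
  have h1 : Real.cosh (ν * t) ≤ Real.exp (|ν| * t) := by
    simpa [abs_mul, abs_of_pos ht] using cosh_le_exp_abs (ν * t)
  have h2 : t ^ 2 / 4 ≤ Real.cosh t := by
    have := Real.quadratic_le_exp_of_nonneg ht.le
    have := exp_div_two_le_cosh t
    linarith
  calc Real.exp (-x * Real.cosh t) * Real.cosh (ν * t)
      ≤ Real.exp (-x * (t ^ 2 / 4)) * Real.exp (|ν| * t) := by
        exact mul_le_mul (Real.exp_le_exp.2 (by nlinarith)) h1 (Real.cosh_pos _).le
          (Real.exp_pos _).le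
    _ = Real.exp (-x * (t ^ 2 / 4) + |ν| * t) := (Real.exp_add _ _).symm
    _ ≤ Real.exp ((|ν| + 1) ^ 2 / x + -t) := by
        refine Real.exp_le_exp.2 ?_
        -- Completing the square; this is where the constant `(|ν| + 1)² / x` in the dominating
        -- function comes from.
        have : (|ν| + 1) ^ 2 / x + -t - (-x * (t ^ 2 / 4) + |ν| * t) =
            (x * t / 2 - (|ν| + 1)) ^ 2 / x := by field_simp; ring
        have : 0 ≤ (x * t / 2 - (|ν| + 1)) ^ 2 / x := by positivity
        linarith
    _ = _ := Real.exp_add _ _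

lemma besselK_nonneg (ν x : ℝ) : 0 ≤ besselK ν x :=
  integral_nonneg fun _ => mul_nonneg (Real.exp_pos _).le (Real.cosh_pos _).le

/-- Only `t ∈ (0, δ]` is kept. For small `δ` the rate `cosh δ` is as close to `1` as desired, at the
cost of a mere constant factor. -/
lemma le_besselK (ν : ℝ) {x δ : ℝ} (hx : 0 < x) (hδ : 0 < δ) :
    δ * Real.exp (-x * Real.cosh δ) ≤ besselK ν x := by
  have hint := integrableOn_besselK_integrand ν hx
  have hsub : Set.Ioc 0 δ ⊆ Set.Ioi 0 := Set.Ioc_subset_Ioi_self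
  calc δ * Real.exp (-x * Real.cosh δ)
      = ∫ t in Set.Ioc 0 δ, Real.exp (-x * Real.cosh δ) := by
        rw [setIntegral_const]; simp [hδ.le]
    _ ≤ ∫ t in Set.Ioc 0 δ, Real.exp (-x * Real.cosh t) * Real.cosh (ν * t) := by
        refine setIntegral_mono_on (by simp) (hint.mono_set hsub) measurableSet_Ioc fun t ht => ?_
        have h1 : Real.cosh t ≤ Real.cosh δ :=
          Real.cosh_le_cosh.2 (by rw [abs_of_pos ht.1, abs_of_pos hδ]; exact ht.2)
        have h2 := Real.one_le_cosh (ν * t)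
        calc Real.exp (-x * Real.cosh δ) ≤ Real.exp (-x * Real.cosh t) * 1 := by
              rw [mul_one]; exact Real.exp_le_exp.2 (by nlinarith)
          _ ≤ _ := by gcongr
    _ ≤ _ := setIntegral_mono_set hint
        (Eventually.of_forall fun _ => mul_nonneg (Real.exp_pos _).le (Real.cosh_pos _).le)
        hsub.eventuallyLE

/-- Passing to the lower integral allows Tonelli in the moment estimate without any joint
integrability. -/
lemma ofReal_besselK_le (ν x : ℝ) : ENNReal.ofReal (besselK ν x) ≤
    ∫⁻ t in Set.Ioi 0, ENNReal.ofReal (Real.exp (-x * Real.cosh t) * Real.cosh (ν * t)) := by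
  have := enorm_integral_le_lintegral_enorm (μ := volume.restrict (Set.Ioi 0))
    (fun t => Real.exp (-x * Real.cosh t) * Real.cosh (ν * t))
  rw [← besselK, Real.enorm_eq_ofReal (besselK_nonneg ν x)] at this
  refine this.trans (le_of_eq (lintegral_congr fun t => ?_))
  exact Real.enorm_eq_ofReal (mul_nonneg (Real.exp_pos _).le (Real.cosh_pos _).le)

lemma measurable_besselK (ν : ℝ) : Measurable (besselK ν) := by
  have : Measurable (Function.uncurry fun x t : ℝ =>
      Real.exp (-x * Real.cosh t) * Real.cosh (ν * t)) := by
    unfold Function.uncurry; fun_prop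
  exact (this.stronglyMeasurable.integral_prod_right'
    (ν := volume.restrict (Set.Ioi 0))).measurable

lemma measurable_gammaGammaPDF (a b : ℝ) : Measurable (gammaGammaPDF a b) := by
  unfold gammaGammaPDF
  refine Measurable.indicator ?_ measurableSet_Ioi
  have := (measurable_besselK (a - b)).comp
    (show Measurable fun y : ℝ => 2 * √(a * b * y) by fun_prop)
  exact Measurable.mul (by fun_prop) this

lemma measurable_pointingErrorPDF (ξ A₀ : ℝ) : Measurable (pointingErrorPDF ξ A₀) := by
  unfold pointingErrorPDF
  exact Measurable.indicator (by fun_prop) measurableSet_Icc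

lemma gammaGammaPDF_of_pos {a b x : ℝ} (ha : 0 < a) (hb : 0 < b) (hx : 0 < x) :
    gammaGammaPDF a b x = 2 * (a * b) ^ ((a + b) / 2) / (Real.Gamma a * Real.Gamma b)
      * x ^ ((a + b) / 2 - 1) * besselK (a - b) (2 * √(a * b) * √x) := by
  have := Set.indicator_of_mem (show x ∈ Set.Ioi (0 : ℝ) from hx)
    (fun y => 2 * (a * b) ^ ((a + b) / 2) / (Real.Gamma a * Real.Gamma b)
      * y ^ ((a + b) / 2 - 1) * besselK (a - b) (2 * Real.sqrt (a * b * y)))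
  rw [gammaGammaPDF, this, Real.sqrt_mul (by positivity), mul_assoc 2]

lemma lintegral_rpow_mul_exp_neg_mul_sqrt {s κ : ℝ} (hs : 0 < s) (hκ : 0 < κ) :
    ∫⁻ x in Set.Ioi 0, ENNReal.ofReal (x ^ (s - 1) * Real.exp (-κ * √x)) =
      ENNReal.ofReal (κ ^ (-(2 * s)) * (2 * Real.Gamma (2 * s))) := by
  have e : ∀ x : ℝ, x ^ (s - 1) * Real.exp (-κ * √x) =
      x ^ (s - 1) * Real.exp (-κ * x ^ (1 / 2 : ℝ)) := fun x => by rw [Real.sqrt_eq_rpow]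
  simp_rw [e]
  rw [← ofReal_integral_eq_lintegral_ofReal
    (integrableOn_rpow_mul_exp_neg_mul_rpow (by linarith) (by norm_num) hκ),
    integral_rpow_mul_exp_neg_mul_rpow (by norm_num) (by linarith) hκ]
  · congr 1
    rw [show (s - 1 + 1) / (1 / 2) = 2 * s by ring,
      show -(s - 1 + 1) / (1 / 2) = -(2 * s) by ring]
    ring
  · filter_upwards [ae_restrict_mem measurableSet_Ioi] with x (hx : 0 < x)
    positivity

/-- The `cosh`-integral that controls the exponential moments of the Gamma-Gamma law. -/
lemma lintegral_cosh_mul_rpow_ne_top {ν s κ : ℝ} (hν : |ν| < 2 * s) (hκ : 0 < κ) :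
    ∫⁻ t in Set.Ioi 0, ENNReal.ofReal (Real.cosh (ν * t) * (κ * Real.cosh t) ^ (-(2 * s))) ≠ ∞ := by
  have hr : 0 < 2 * s - |ν| := by linarith
  have hint := (exp_neg_integrableOn_Ioi 0 hr).const_mul ((κ / 2) ^ (-(2 * s)))
  refine ne_top_of_le_ne_top hint.lintegral_lt_top.ne ?_
  refine setLIntegral_mono_ae (by fun_prop) (Eventually.of_forall fun t (ht : 0 < t) => ?_)
  refine ENNReal.ofReal_le_ofReal ?_
  have h1 : Real.cosh (ν * t) ≤ Real.exp (|ν| * t) := by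
    simpa [abs_mul, abs_of_pos ht] using cosh_le_exp_abs (ν * t)
  have h0 : 0 < κ / 2 * Real.exp t := by positivity
  have h2 : (κ * Real.cosh t) ^ (-(2 * s)) ≤ (κ / 2 * Real.exp t) ^ (-(2 * s)) := by
    refine Real.rpow_le_rpow_of_nonpos h0 ?_ (by have := abs_nonneg ν; linarith)
    have := exp_div_two_le_cosh t
    calc κ / 2 * Real.exp t = κ * (Real.exp t / 2) := by ring
      _ ≤ _ := by gcongr
  have hc := Real.cosh_pos t
  calc Real.cosh (ν * t) * (κ * Real.cosh t) ^ (-(2 * s))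
      ≤ Real.exp (|ν| * t) * (κ / 2 * Real.exp t) ^ (-(2 * s)) := by gcongr
    _ = (κ / 2) ^ (-(2 * s)) * Real.exp (-(2 * s - |ν|) * t) := by
        rw [Real.mul_rpow (by positivity) (Real.exp_pos _).le, ← Real.exp_mul,
          mul_left_comm, ← Real.exp_add]
        congr 2; ring

/-- Insert the integral for `K` and swap. As `cosh t ≥ 1`, the weight `exp (θ √x)` is absorbed by
replacing `β cosh t` with `(β - θ) cosh t`. The `x`-integral is then a Gamma integral, leaving `cosh
((a - b) t)` against `(cosh t) ^ (-(a + b))`, integrable because `|a - b| < a + b`. -/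
lemma gammaGammaLaw_moment {a b θ : ℝ} (ha : 0 < a) (hb : 0 < b) (hθ : 0 < θ)
    (hθβ : θ < 2 * √(a * b)) :
    ∫⁻ g, ENNReal.ofReal (Real.exp (θ * √g)) ∂(gammaGammaLaw a b) ≠ ∞ := by
  set β := 2 * √(a * b) with hβ
  set s := (a + b) / 2 with hs
  set ν := a - b with hν
  set C := 2 * (a * b) ^ s / (Real.Gamma a * Real.Gamma b) with hC
  have hs0 : 0 < s := by positivity
  have hC0 : 0 ≤ C := by
    have := Real.Gamma_pos_of_pos ha
    have := Real.Gamma_pos_of_pos hb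
    positivity
  have hνs : |ν| < 2 * s := by rw [abs_lt]; constructor <;> linarith
  rw [gammaGammaLaw, lintegral_withDensity_eq_lintegral_mul _
    (measurable_gammaGammaPDF a b).ennreal_ofReal (by fun_prop)]
  have hsupp : ∀ g, ((fun x => ENNReal.ofReal (gammaGammaPDF a b x)) *
      fun g => ENNReal.ofReal (Real.exp (θ * √g))) g =
      (Set.Ioi 0).indicator ((fun x => ENNReal.ofReal (gammaGammaPDF a b x)) *
      fun g => ENNReal.ofReal (Real.exp (θ * √g))) g := by
    intro g
    by_cases hg : g ∈ Set.Ioi (0 : ℝ)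
    · rw [Set.indicator_of_mem hg]
    · rw [Set.indicator_of_notMem hg]
      simp [gammaGammaPDF, Set.indicator_of_notMem hg]
  rw [lintegral_congr hsupp, lintegral_indicator measurableSet_Ioi]
  have hpt : ∀ x ∈ Set.Ioi (0 : ℝ), ((fun x => ENNReal.ofReal (gammaGammaPDF a b x)) *
      fun g => ENNReal.ofReal (Real.exp (θ * √g))) x ≤
      ∫⁻ t in Set.Ioi (0 : ℝ), ENNReal.ofReal (C * Real.cosh (ν * t)) *
        ENNReal.ofReal (x ^ (s - 1) * Real.exp (-((β - θ) * Real.cosh t) * √x)) := by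
    intro x (hx : 0 < x)
    simp only [Pi.mul_apply]
    rw [gammaGammaPDF_of_pos ha hb hx, ENNReal.ofReal_mul (by positivity)]
    calc ENNReal.ofReal (C * x ^ (s - 1)) * ENNReal.ofReal (besselK ν (β * √x)) *
          ENNReal.ofReal (Real.exp (θ * √x))
        ≤ ENNReal.ofReal (C * x ^ (s - 1)) * (∫⁻ t in Set.Ioi 0, ENNReal.ofReal
            (Real.exp (-(β * √x) * Real.cosh t) * Real.cosh (ν * t))) *
          ENNReal.ofReal (Real.exp (θ * √x)) := by
          gcongr
          exact ofReal_besselK_le _ _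
      _ = ∫⁻ t in Set.Ioi 0, ENNReal.ofReal (C * x ^ (s - 1)) * ENNReal.ofReal
            (Real.exp (-(β * √x) * Real.cosh t) * Real.cosh (ν * t)) *
          ENNReal.ofReal (Real.exp (θ * √x)) := by
          rw [lintegral_mul_const _ (by fun_prop), lintegral_const_mul _ (by fun_prop)]
      _ ≤ _ := by
          refine lintegral_mono fun t => ?_
          have hc := Real.cosh_pos (ν * t)
          have hx' : 0 < x ^ (s - 1) := Real.rpow_pos_of_pos hx _
          rw [← ENNReal.ofReal_mul (by positivity), ← ENNReal.ofReal_mul (by positivity),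
            ← ENNReal.ofReal_mul (by positivity)]
          refine ENNReal.ofReal_le_ofReal ?_
          have he : Real.exp (-(β * √x) * Real.cosh t) * Real.exp (θ * √x) ≤
              Real.exp (-((β - θ) * Real.cosh t) * √x) := by
            rw [← Real.exp_add]
            refine Real.exp_le_exp.2 ?_
            have h1 := Real.one_le_cosh t
            have : 0 ≤ θ * √x * (Real.cosh t - 1) :=
              mul_nonneg (by positivity) (by linarith)
            linarith
          calc C * x ^ (s - 1) * (Real.exp (-(β * √x) * Real.cosh t) * Real.cosh (ν * t)) *
                Real.exp (θ * √x)
              = C * Real.cosh (ν * t) * (x ^ (s - 1) *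
                (Real.exp (-(β * √x) * Real.cosh t) * Real.exp (θ * √x))) := by ring
            _ ≤ _ := by gcongr
  refine ne_top_of_le_ne_top ?_ (setLIntegral_mono' measurableSet_Ioi hpt)
  rw [lintegral_lintegral_swap (by unfold Function.uncurry; fun_prop)]
  have hinner : ∀ t : ℝ, ∫⁻ x in Set.Ioi (0 : ℝ), ENNReal.ofReal (C * Real.cosh (ν * t)) *
        ENNReal.ofReal (x ^ (s - 1) * Real.exp (-((β - θ) * Real.cosh t) * √x)) =
      ENNReal.ofReal (C * (2 * Real.Gamma (2 * s))) *
        ENNReal.ofReal (Real.cosh (ν * t) * ((β - θ) * Real.cosh t) ^ (-(2 * s))) := by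
    intro t
    have hc := Real.cosh_pos (ν * t)
    have hG := Real.Gamma_pos_of_pos (show 0 < 2 * s by positivity)
    rw [lintegral_const_mul _ (by fun_prop), lintegral_rpow_mul_exp_neg_mul_sqrt hs0
      (mul_pos (by linarith) (Real.cosh_pos t)), ← ENNReal.ofReal_mul (by positivity),
      ← ENNReal.ofReal_mul (by positivity)]
    congr 1
    ring
  simp_rw [hinner]
  rw [lintegral_const_mul _ (by fun_prop)]
  exact ENNReal.mul_ne_top ENNReal.ofReal_ne_top
    (lintegral_cosh_mul_rpow_ne_top hνs (by linarith))

/-- Lets a tail be bounded below by the mass of `(t, t + 1]`: moving to the right endpoint costs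
only an arbitrarily small increase of the exponent. -/
lemma eventually_mul_sqrt_add_one_le {θ' θ : ℝ} (hθ' : 0 < θ') (h : θ' < θ) :
    ∀ᶠ t in atTop, θ' * √(t + 1) ≤ θ * √t := by
  have hd : 0 < θ ^ 2 - θ' ^ 2 := by nlinarith
  filter_upwards [eventually_ge_atTop (θ' ^ 2 / (θ ^ 2 - θ' ^ 2)), eventually_ge_atTop 0]
    with t ht ht0
  rw [div_le_iff₀ hd] at ht
  refine abs_le_of_sq_le_sq' ?_ (by have := hθ'.trans h; positivity) |>.2
  rw [mul_pow, mul_pow, Real.sq_sqrt (by linarith), Real.sq_sqrt ht0]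
  linarith

/-- The gap `exp ((θ - κ) √x)` beats every power and constant; all prefactors are discarded through
this. -/
lemma eventually_exp_le_rpow_mul_exp {C s κ θ : ℝ} (hC : 0 < C) (h : κ < θ) :
    ∀ᶠ x in atTop, Real.exp (-(θ * √x)) ≤ C * x ^ s * Real.exp (-(κ * √x)) := by
  have h1 := (tendsto_exp_mul_div_rpow_atTop (-(2 * s)) (θ - κ) (by linarith)).comp
    Real.tendsto_sqrt_atTop
  filter_upwards [h1.eventually_ge_atTop C⁻¹, eventually_gt_atTop 0] with x hx hx0
  have e : (√x) ^ (-(2 * s)) = (x ^ s)⁻¹ := by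
    rw [Real.sqrt_eq_rpow, ← Real.rpow_mul hx0.le, ← Real.rpow_neg hx0.le]
    congr 1; ring
  simp only [Function.comp, e, div_inv_eq_mul] at hx
  have h2 : 1 ≤ C * (Real.exp ((θ - κ) * √x) * x ^ s) := by
    calc 1 = C * C⁻¹ := (mul_inv_cancel₀ hC.ne').symm
      _ ≤ _ := by gcongr
  calc Real.exp (-(θ * √x)) = 1 * Real.exp (-(θ * √x)) := (one_mul _).symm
    _ ≤ C * (Real.exp ((θ - κ) * √x) * x ^ s) * Real.exp (-(θ * √x)) := by gcongr
    _ = C * x ^ s * (Real.exp ((θ - κ) * √x) * Real.exp (-(θ * √x))) := by ring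
    _ = _ := by rw [← Real.exp_add]; congr 2; ring

lemma eventually_exp_le_gammaGammaPDF {a b θ : ℝ} (ha : 0 < a) (hb : 0 < b)
    (hθ : 2 * √(a * b) < θ) :
    ∀ᶠ x in atTop, Real.exp (-(θ * √x)) ≤ gammaGammaPDF a b x := by
  set β := 2 * √(a * b) with hβ
  have hβ0 : 0 < β := by positivity
  have hcont : ContinuousAt (fun δ => β * Real.cosh δ) 0 := by fun_prop
  have hev : ∀ᶠ δ in 𝓝[>] (0 : ℝ), β * Real.cosh δ < θ :=
    nhdsWithin_le_nhds (hcont.eventually (gt_mem_nhds (by simpa using hθ)))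
  -- `δ` is small enough that `β cosh δ`, the decay rate in `le_besselK`, is still below `θ`.
  obtain ⟨δ, hδθ, hδ : 0 < δ⟩ := (hev.and self_mem_nhdsWithin).exists
  have hC : 0 < 2 * (a * b) ^ ((a + b) / 2) / (Real.Gamma a * Real.Gamma b) := by
    have := Real.Gamma_pos_of_pos ha
    have := Real.Gamma_pos_of_pos hb
    positivity
  filter_upwards [eventually_exp_le_rpow_mul_exp (s := (a + b) / 2 - 1) (mul_pos hC hδ) hδθ,
    eventually_gt_atTop 0] with x hx hx0
  refine hx.trans ?_
  rw [gammaGammaPDF_of_pos ha hb hx0]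
  have hK := le_besselK (a - b) (show 0 < β * √x by positivity) hδ
  rw [mul_right_comm _ δ, mul_assoc _ δ]
  gcongr
  refine le_trans (le_of_eq ?_) hK
  congr 2; ring

theorem hasSqrtExpTail_gammaGammaLaw {a b : ℝ} (ha : 0 < a) (hb : 0 < b) :
    HasSqrtExpTail (gammaGammaLaw a b) (2 * √(a * b)) where
  pos := by
    rw [gammaGammaLaw, ae_withDensity_iff (measurable_gammaGammaPDF a b).ennreal_ofReal]
    refine Eventually.of_forall fun x hx => ?_
    by_contra h
    exact hx (by simp [gammaGammaPDF, Set.indicator_of_notMem (show x ∉ Set.Ioi (0 : ℝ) from h)])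
  moment θ hθ hθβ := gammaGammaLaw_moment ha hb hθ hθβ
  tail θ hθ := by
    obtain ⟨θ', h1, h2⟩ := exists_between hθ
    have hθ' : 0 < θ' := lt_of_le_of_lt (by positivity) h1
    obtain ⟨T, hT⟩ := eventually_atTop.1 (eventually_exp_le_gammaGammaPDF ha hb h1)
    filter_upwards [eventually_ge_atTop T, eventually_mul_sqrt_add_one_le hθ' h2] with t ht h3
    calc ENNReal.ofReal (Real.exp (-(θ * √t)))
        ≤ ENNReal.ofReal (Real.exp (-(θ' * √(t + 1)))) :=
          ENNReal.ofReal_le_ofReal (Real.exp_le_exp.2 (by linarith))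
      _ = ∫⁻ x in Set.Ioc t (t + 1), ENNReal.ofReal (Real.exp (-(θ' * √(t + 1)))) := by
          rw [setLIntegral_const]; simp
      _ ≤ ∫⁻ x in Set.Ioc t (t + 1), ENNReal.ofReal (gammaGammaPDF a b x) := by
          refine setLIntegral_mono' measurableSet_Ioc fun x hx => ENNReal.ofReal_le_ofReal ?_
          refine le_trans (Real.exp_le_exp.2 ?_) (hT x (ht.trans hx.1.le))
          have := Real.sqrt_le_sqrt hx.2
          nlinarith
      _ = gammaGammaLaw a b (Set.Ioc t (t + 1)) :=
          (withDensity_apply _ measurableSet_Ioc).symm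
      _ ≤ _ := measure_mono Set.Ioc_subset_Ioi_self

/-! ### The pointing-error factor and the composite law -/

/-- Multiplying by an independent bounded factor rescales the tail by its essential supremum. -/
theorem HasSqrtExpTail.map_mul_prod {μ ν : Measure ℝ} [IsFiniteMeasure ν] {β A : ℝ}
    (h : HasSqrtExpTail μ β) (hβ : 0 < β) (hA : 0 < A) (hν : ∀ᵐ y ∂ν, 0 < y ∧ y ≤ A)
    (hνA : ∀ r < A, 0 < ν (Set.Ioi r)) :
    HasSqrtExpTail ((μ.prod ν).map (fun p : ℝ × ℝ => p.1 * p.2)) (β / √A) := by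
  have := h.isFiniteMeasure hβ
  have hmul : Measurable fun p : ℝ × ℝ => p.1 * p.2 := by fun_prop
  have hae1 : ∀ᵐ p ∂(μ.prod ν), 0 < p.1 := Measure.quasiMeasurePreserving_fst.ae h.pos
  have hae2 : ∀ᵐ p ∂(μ.prod ν), 0 < p.2 ∧ p.2 ≤ A := Measure.quasiMeasurePreserving_snd.ae hν
  have hsA : 0 < √A := Real.sqrt_pos.2 hA
  refine ⟨?_, fun θ hθ hθβ => ?_, fun θ hθ => ?_⟩
  · rw [ae_map_iff hmul.aemeasurable measurableSet_Ioi]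
    filter_upwards [hae1, hae2] with p h1 h2 using mul_pos h1 h2.1
  · rw [lintegral_map (by fun_prop) hmul]
    have hle : ∫⁻ p, ENNReal.ofReal (Real.exp (θ * √(p.1 * p.2))) ∂(μ.prod ν) ≤
        ∫⁻ p, ENNReal.ofReal (Real.exp (θ * √A * √p.1)) ∂(μ.prod ν) := by
      refine lintegral_mono_ae ?_
      filter_upwards [hae1, hae2] with p h1 h2
      refine ENNReal.ofReal_le_ofReal (Real.exp_le_exp.2 ?_)
      rw [mul_assoc, ← Real.sqrt_mul hA.le, mul_comm A]
      have := h2.2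
      gcongr
    refine ne_top_of_le_ne_top ?_ hle
    rw [lintegral_prod _ (by fun_prop)]
    simp only [lintegral_const]
    rw [lintegral_mul_const _ (by fun_prop)]
    exact ENNReal.mul_ne_top (h.moment _ (by positivity) ((lt_div_iff₀ hsA).1 hθβ))
      (measure_ne_top _ _)
  · rw [div_lt_iff₀ hsA] at hθ
    have hcont : ContinuousAt (fun r => θ * √r) A := by fun_prop
    have hev : ∀ᶠ r in 𝓝[<] A, β < θ * √r ∧ 0 < r :=
      nhdsWithin_le_nhds ((hcont.eventually (lt_mem_nhds hθ)).and (lt_mem_nhds hA))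
    -- A level `r` just below the essential supremum: the product exceeds `t` on the rectangle where
    -- the gain exceeds `t / r` and the factor exceeds `r`. The constant mass `c` of the latter
    -- event is absorbed by the gap `θ' / √r < θ`.
    obtain ⟨r, ⟨hr, hr0⟩, hrA : r < A⟩ := (hev.and self_mem_nhdsWithin).exists
    obtain ⟨θ', h1, h2⟩ := exists_between hr
    have hsr : 0 < √r := Real.sqrt_pos.2 hr0
    set c := ν.real (Set.Ioi r) with hc
    have hc0 : 0 < c := ENNReal.toReal_pos (hνA r hrA).ne' (measure_ne_top _ _)
    have hκ : θ' / √r < θ := (div_lt_iff₀ hsr).2 h2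
    have htr : Tendsto (fun t : ℝ => t / r) atTop atTop := tendsto_id.atTop_div_const hr0
    filter_upwards [eventually_exp_le_rpow_mul_exp (s := 0) hc0 hκ,
      htr.eventually (h.tail θ' h1), eventually_gt_atTop 0] with t h3 h4 ht
    rw [Measure.map_apply hmul measurableSet_Ioi]
    calc ENNReal.ofReal (Real.exp (-(θ * √t)))
        ≤ ENNReal.ofReal (Real.exp (-(θ' * √(t / r))) * c) := by
          refine ENNReal.ofReal_le_ofReal (h3.trans (le_of_eq ?_))
          rw [Real.rpow_zero, mul_one, mul_comm, Real.sqrt_div ht.le]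
          congr 3; ring
      _ = ENNReal.ofReal (Real.exp (-(θ' * √(t / r)))) * ν (Set.Ioi r) := by
          rw [ENNReal.ofReal_mul (Real.exp_pos _).le, hc, ofReal_measureReal]
      _ ≤ μ (Set.Ioi (t / r)) * ν (Set.Ioi r) := by gcongr
      _ = μ.prod ν (Set.Ioi (t / r) ×ˢ Set.Ioi r) := (Measure.prod_prod _ _).symm
      _ ≤ _ := by
          refine measure_mono fun p hp => ?_
          have hp1 : t / r < p.1 := hp.1
          have hp2 : r < p.2 := hp.2
          show t < p.1 * p.2
          calc t = t / r * r := (div_mul_cancel₀ t hr0.ne').symm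
            _ < p.1 * p.2 := by
              have : 0 < t / r := by positivity
              gcongr

lemma isFiniteMeasure_pointingErrorLaw {ξ A₀ : ℝ} (hξ : 0 < ξ) (hA₀ : 0 < A₀) :
    IsFiniteMeasure (pointingErrorLaw ξ A₀) := by
  refine isFiniteMeasure_withDensity_ofReal (Integrable.hasFiniteIntegral ?_)
  have h := intervalIntegral.intervalIntegrable_rpow' (a := 0) (b := A₀) (r := ξ ^ 2 - 1)
    (by have := pow_pos hξ 2; linarith)
  rw [intervalIntegrable_iff_integrableOn_Icc_of_le hA₀.le] at h
  exact (integrable_indicator_iff measurableSet_Icc).2 (h.const_mul _)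

lemma ae_mem_pointingErrorLaw (ξ A₀ : ℝ) : ∀ᵐ y ∂(pointingErrorLaw ξ A₀), 0 < y ∧ y ≤ A₀ := by
  rw [pointingErrorLaw, ae_withDensity_iff (measurable_pointingErrorPDF ξ A₀).ennreal_ofReal]
  filter_upwards [Measure.ae_ne volume (0 : ℝ)] with y hy hy'
  have hmem : y ∈ Set.Icc 0 A₀ := by
    by_contra h
    exact hy' (by simp [pointingErrorPDF, Set.indicator_of_notMem h])
  exact ⟨lt_of_le_of_ne hmem.1 (Ne.symm hy), hmem.2⟩

lemma pointingErrorLaw_Ioi_pos {ξ A₀ r : ℝ} (hξ : 0 < ξ) (hA₀ : 0 < A₀) (hr : r < A₀) :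
    0 < pointingErrorLaw ξ A₀ (Set.Ioi r) := by
  rw [pointingErrorLaw, withDensity_apply _ measurableSet_Ioi,
    setLIntegral_pos_iff (measurable_pointingErrorPDF ξ A₀).ennreal_ofReal]
  -- `r` may be negative, while the density is positive only on `(0, A₀]`.
  have hlt : max r 0 < A₀ := max_lt hr hA₀
  have hvol : 0 < volume (Set.Ioc (max r 0) A₀) := by simpa using hlt
  refine hvol.trans_le (measure_mono fun y hy => ⟨?_, (le_max_left _ _).trans_lt hy.1⟩)
  have hy0 : 0 < y := (le_max_right _ _).trans_lt hy.1
  have hmem : y ∈ Set.Icc 0 A₀ := ⟨hy0.le, hy.2⟩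
  simp only [Function.mem_support, pointingErrorPDF, Set.indicator_of_mem hmem, ne_eq,
    ENNReal.ofReal_eq_zero, not_le]
  positivity

theorem hasSqrtExpTail_compositeLaw {a b ξ A₀ : ℝ} (ha : 0 < a) (hb : 0 < b) (hξ : 0 < ξ)
    (hA₀ : 0 < A₀) : HasSqrtExpTail (compositeLaw a b ξ A₀) (2 * √(a * b) / √A₀) := by
  have := isFiniteMeasure_pointingErrorLaw hξ hA₀
  exact (hasSqrtExpTail_gammaGammaLaw ha hb).map_mul_prod (by positivity) hA₀
    (ae_mem_pointingErrorLaw ξ A₀) fun r hr => pointingErrorLaw_Ioi_pos hξ hA₀ hr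

end GammaGammaChannel

theorem corollary3 (a b ξ A₀ N : ℝ) (k : ℕ)
    (ha : 0 < a) (hb : 0 < b) (hξ : 0 < ξ) (hA₀ : 0 < A₀) (hA₀_le : A₀ ≤ 1)
    (hN : 0 < N) (hk : k = 1 ∨ k = 2) :
    -- both capacities are finite and are attained maxima at every positive SNR
    (∀ snr : ℝ, 0 < snr →
      (IsGreatest (GammaGammaChannel.achievableRates
          (GammaGammaChannel.compositeLaw a b ξ A₀) k N (snr * N))
        (GammaGammaChannel.ergodicCapacity
          (GammaGammaChannel.compositeLaw a b ξ A₀) k N (snr * N)) ∧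
      GammaGammaChannel.ergodicCapacity
          (GammaGammaChannel.compositeLaw a b ξ A₀) k N (snr * N) ≠ ∞) ∧
      (IsGreatest (GammaGammaChannel.achievableRates
          (GammaGammaChannel.gammaGammaLaw a b) k N (snr * N))
        (GammaGammaChannel.ergodicCapacity
          (GammaGammaChannel.gammaGammaLaw a b) k N (snr * N)) ∧
      GammaGammaChannel.ergodicCapacity
          (GammaGammaChannel.gammaGammaLaw a b) k N (snr * N) ≠ ∞)) ∧
    -- low-SNR asymptotic capacity with pointing error
    Asymptotics.IsEquivalent (𝓝[>] (0 : ℝ))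
      (GammaGammaChannel.capacityAtSNR (GammaGammaChannel.compositeLaw a b ξ A₀) k N)
      (fun snr => 1 / (k : ℝ) * (A₀ / (4 * a * b) * snr * Real.log (1 / snr) ^ 2)) ∧
    -- low-SNR asymptotic capacity without pointing error
    Asymptotics.IsEquivalent (𝓝[>] (0 : ℝ))
      (GammaGammaChannel.capacityAtSNR (GammaGammaChannel.gammaGammaLaw a b) k N)
      (fun snr => 1 / (k : ℝ) * (1 / (4 * a * b) * snr * Real.log (1 / snr) ^ 2)) ∧
    -- the pointing error scales the low-SNR capacity by the factor `A₀`
    Tendsto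
      (fun snr => GammaGammaChannel.capacityAtSNR (GammaGammaChannel.compositeLaw a b ξ A₀) k N snr
        / GammaGammaChannel.capacityAtSNR (GammaGammaChannel.gammaGammaLaw a b) k N snr)
      (𝓝[>] (0 : ℝ)) (𝓝 A₀) := by
  have hk0 : k ≠ 0 := by rcases hk with rfl | rfl <;> norm_num
  have hGG := GammaGammaChannel.hasSqrtExpTail_gammaGammaLaw ha hb
  have hPE := GammaGammaChannel.hasSqrtExpTail_compositeLaw ha hb hξ hA₀
  have hβ : 0 < 2 * √(a * b) := by positivity
  have hβ' : 0 < 2 * √(a * b) / √A₀ := by positivity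
  have e : (2 * √(a * b)) ^ 2 = 4 * a * b := by
    rw [mul_pow, Real.sq_sqrt (by positivity)]; ring
  have e' : (2 * √(a * b) / √A₀) ^ 2 = 4 * a * b / A₀ := by
    rw [div_pow, e, Real.sq_sqrt hA₀.le]
  refine ⟨fun snr hsnr => ⟨⟨hPE.ergodicCapacity_isGreatest hβ' k hN hsnr,
      hPE.ergodicCapacity_ne_top hβ' hk0 hN hsnr⟩,
    hGG.ergodicCapacity_isGreatest hβ k hN hsnr,
      hGG.ergodicCapacity_ne_top hβ hk0 hN hsnr⟩, ?_, ?_, ?_⟩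
  · have := hPE.isEquivalent_capacityAtSNR hβ' hk0 hN
    rwa [e', one_div_div] at this
  · have := hGG.isEquivalent_capacityAtSNR hβ hk0 hN
    rwa [e] at this
  · have := hPE.tendsto_capacityAtSNR_div hGG hβ' hβ hk0 hN
    rwa [e, e', div_div_cancel₀ (by positivity)] at this
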